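/- Let $\tau>1$, $\alpha>0$ and $\eta>0$ be constants with $\tau\eta^\alpha<1$. For a bounded measurable function $q$ on $[0,1]$ with $\sup|q|\le 1$ and for $\lambda\in[\sqrt{\tau\eta^\alpha},1]$ put $$D_B[q](\lambda)=\int_0^1\sqrt{1+\frac{\eta^\alpha}{\lambda^2}\,q(s)}\,ds .$$ (i) The data is invariant under rearrangements: if $q_1,q_2$ are measurable on $[0,1]$ with $\sup|q_i|\le1$ and $$\mathrm{meas}\{t\in[0,1]: q_1(t)>y\}=\mathrm{meas}\{t\in[0,1]: q_2(t)>y\}\quad\text{for all }y\in[-1,1],$$ then $D_B[q_1](\lambda)=D_B[q_2](\lambda)$ for all $\lambda\in[\sqrt{\tau\eta^\alpha},1]$. (ii) Call $q$ admissible if $q\in C^1([0,1])$ is strictly increasing, $\sup|q|\le1$, and $q^{-1}\in C^1([q(0),q(1)])$. The data determines an admissible $q$ uniquely among admissible functions: if $q_1,q_2$ are admissible and $D_B[q_1]=D_B[q_2]$ on $[\sqrt{\tau\eta^\alpha},1]$, then $q_1=q_2$ on $[0,1]$. (iii) Let $\mathcal L f(s)=\int_0^\infty e^{-st}f(t)\,dt$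 be the Laplace transform and $F_0f(s)=\int_0^\infty t f(t)J_0(st)\,dt$ the Hankel transform of order $0$, where $J_0$ is the Bessel function of the first kind of order $0$. For an admissible $q$ with $q(0)\ge0$ put $Q(x)=\mathbf 1_{(q(0),q(1))}(x^2)\,(q^{-1})'(x^2)$. Then, for all $\lambda\in[\sqrt{\tau\eta^\alpha},1]$, the integrals below converge absolutely, $D_B[q]$ is differentiable (one-sidedly at the end points) and $$\frac1\lambda D_B[q](\lambda)+\frac{d D_B[q]}{d\lambda}(\lambda)=\frac{2}{\sqrt{\eta^\alpha}}\,\mathcal L F_0Q\!\left(\frac{\lambda}{\sqrt{\eta^\alpha}}\right).$$ For an admissible $q$ of any sign the same holds with $\mathcal L F_0 Q$ replaced by $\mathcal L F_0Q+\mathcal L\widetilde F_0 Q^-$, where $Q^-(x)=\mathbf 1_{(q(0),q(1))}(-x^2)\,(q^{-1})'(-x^2)$, $\widetilde F_0f(s)=\int_0^\infty t f(t)I_0(st)\,dt$ and $I_0(x)=J_0(ix)$ is the modified Bessel function; the additional term vanishes when $q(0)\ge 0$. -/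

import Mathlib

open Set MeasureTheory

noncomputable section

namespace ProblemB

/-- The data `λ ↦ ∫₀¹ √(1 + (η^α / λ²) q(s)) ds`. -/
def data (α η : ℝ) (q : ℝ → ℝ) (lam : ℝ) : ℝ :=
  ∫ s in (0 : ℝ)..1, Real.sqrt (1 + η ^ α / lam ^ 2 * q s)

/-- The interval `[√(τ η^α), 1]` of observed parameters `λ`. -/
def window (τ α η : ℝ) : Set ℝ := Icc (Real.sqrt (τ * η ^ α)) 1

/-- Two functions on `[0, 1]` with values in `[-1, 1]` are rearrangements of each other
(equimeasurable): for every level `y`, their level sets `{q > y}` have the same Lebesgue measure. -/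
def IsRearrangement (q₁ q₂ : ℝ → ℝ) : Prop :=
  ∀ y ∈ Icc (-1 : ℝ) 1,
    volume {t : ℝ | t ∈ Icc (0 : ℝ) 1 ∧ y < q₁ t} = volume {t : ℝ | t ∈ Icc (0 : ℝ) 1 ∧ y < q₂ t}

/-- The inverse function of `q : [0, 1] → ℝ`; only its values on the range of `q` matter. -/
def inverse (q : ℝ → ℝ) : ℝ → ℝ := Function.invFunOn q (Icc 0 1)

/-- `q` is `C¹` and strictly increasing on `[0, 1]`, `sup |q| ≤ 1`, and `q⁻¹` is `C¹` on
`[q 0, q 1]`. -/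
structure Admissible (q : ℝ → ℝ) : Prop where
  contDiffOn : ContDiffOn ℝ 1 q (Icc 0 1)
  strictMonoOn : StrictMonoOn q (Icc 0 1)
  abs_le_one : ∀ t ∈ Icc (0 : ℝ) 1, |q t| ≤ 1
  contDiffOn_inverse : ContDiffOn ℝ 1 (inverse q) (Icc (q 0) (q 1))

/-- The Bessel function of the first kind of order `0`. -/
def besselJ0 (x : ℝ) : ℝ := ∑' k : ℕ, (-1 : ℝ) ^ k / (k.factorial : ℝ) ^ 2 * (x / 2) ^ (2 * k)

/-- The modified Bessel function of the first kind of order `0`, `I₀(x) = J₀(i x)`. -/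
def besselI0 (x : ℝ) : ℝ := ∑' k : ℕ, 1 / (k.factorial : ℝ) ^ 2 * (x / 2) ^ (2 * k)

/-- The Laplace transform `∫₀^∞ e^{-st} f(t) dt`. -/
def laplace (f : ℝ → ℝ) (s : ℝ) : ℝ := ∫ t in Ioi (0 : ℝ), Real.exp (-(s * t)) * f t

/-- Absolute convergence of the integral defining the Laplace transform at `s`. -/
def LaplaceConverges (f : ℝ → ℝ) (s : ℝ) : Prop :=
  IntegrableOn (fun t => Real.exp (-(s * t)) * f t) (Ioi 0)

/-- The Hankel transform of order `0`, `∫₀^∞ t f(t) J₀(st) dt`. -/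
def hankel0 (f : ℝ → ℝ) (s : ℝ) : ℝ := ∫ t in Ioi (0 : ℝ), t * f t * besselJ0 (s * t)

/-- Absolute convergence of the integral defining the Hankel transform at `s`. -/
def Hankel0Converges (f : ℝ → ℝ) (s : ℝ) : Prop :=
  IntegrableOn (fun t => t * f t * besselJ0 (s * t)) (Ioi 0)

/-- The analogue of the Hankel transform with the kernel `I₀`, `∫₀^∞ t f(t) I₀(st) dt`. -/
def hankelI0 (f : ℝ → ℝ) (s : ℝ) : ℝ := ∫ t in Ioi (0 : ℝ), t * f t * besselI0 (s * t)

/-- Absolute convergence of the integral `∫₀^∞ t f(t) I₀(st) dt`. -/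
def HankelI0Converges (f : ℝ → ℝ) (s : ℝ) : Prop :=
  IntegrableOn (fun t => t * f t * besselI0 (s * t)) (Ioi 0)

/-- The function `1_{(q 0, q 1)} · (q⁻¹)'`. -/
def inverseDensity (q : ℝ → ℝ) : ℝ → ℝ := (Ioo (q 0) (q 1)).indicator (deriv (inverse q))

/-- `Q(x) = 1_{(q 0, q 1)}(x²) (q⁻¹)'(x²)`. -/
def Q (q : ℝ → ℝ) (x : ℝ) : ℝ := inverseDensity q (x ^ 2)

/-- `Q⁻(x) = 1_{(q 0, q 1)}(-x²) (q⁻¹)'(-x²)`, which sees the negative values of `q`; it vanishes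
identically when `q 0 ≥ 0`. -/
def Qneg (q : ℝ → ℝ) (x : ℝ) : ℝ := inverseDensity q (-x ^ 2)

end ProblemB

end

/-! The data depend on `q` only through its distribution `ν`, the image of Lebesgue measure on `[0,
1]`, and equimeasurable functions have the same `ν`; this is (i). Both other parts rest on one
identity. Since `λ D(λ) = ∫ √(λ² + η^α q)`, the expression `D/λ + D'` equals `(λ D)'/λ = ∫ 1/√(λ² +
η^α q)` (`exists_hasDerivAt_data`).

For (ii), put `c = η^α/λ²`. The data then give `∫ 1/√(1 + c y) dν(y)` on an interval of `c` inside
`(0, 1)`. This function is analytic for `|c| < 1`, and its Taylor coefficients at `0` are, up to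
sign, the moments of `ν` times positive constants. The identity theorem thus recovers all moments,
hence the characteristic function and `ν` (`measure_ext_of_integral_invSqrt`). A continuous
increasing `q` is determined by `ν`.

For (iii), substituting `q(s) = ± x²` turns the integral into integrals of `x Q(x)/√(s² + x²)` and
`x Q⁻(x)/√(s² - x²)` with `s = λ/√(η^α) > 1`. These kernels are the Laplace transforms of `J₀(x t)`
and `I₀(x t)` (`laplace_bessel`), and Fubini gives the claim (`laplace_hankel`). A sign `σ = ± 1`
treats both cases together. -/

noncomputable section

namespace ProblemB

/-! ### The binomial series of `1 / √(1 - z)` -/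

/-- The coefficients of the expansion of `1 / √(1 - z)`. -/
def invSqrtCoeff (n : ℕ) : ℝ := n.centralBinom / 4 ^ n

lemma invSqrtCoeff_pos (n : ℕ) : 0 < invSqrtCoeff n := by
  have := Nat.centralBinom_pos n
  unfold invSqrtCoeff
  positivity

lemma invSqrtCoeff_le_one (n : ℕ) : invSqrtCoeff n ≤ 1 := by
  unfold invSqrtCoeff
  rw [div_le_one (by positivity)]
  rcases eq_or_ne n 0 with rfl | h
  · simp
  · exact_mod_cast (Nat.centralBinom_lt_four_pow h).le

lemma invSqrtCoeff_eq_factorial (n : ℕ) :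
    invSqrtCoeff n = ((2 * n).factorial : ℝ) / (4 ^ n * (n.factorial : ℝ) ^ 2) := by
  have h := Nat.choose_mul_factorial_mul_factorial (n := 2 * n) (k := n) (by omega)
  rw [show 2 * n - n = n by omega, ← Nat.centralBinom_eq_two_mul_choose] at h
  unfold invSqrtCoeff
  rw [← h]
  have := Nat.factorial_pos n
  push_cast
  field_simp

lemma ascPochhammer_half_eq (n : ℕ) :
    (ascPochhammer ℝ n).eval (1 / 2) = (n.factorial : ℝ) * invSqrtCoeff n := by
  induction n with
  | zero => simp [invSqrtCoeff]
  | succ n ih =>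
    rw [ascPochhammer_succ_eval, ih]
    have h : ((n : ℝ) + 1) * (n + 1).centralBinom = 2 * (2 * n + 1) * n.centralBinom := by
      exact_mod_cast Nat.succ_mul_centralBinom_succ n
    unfold invSqrtCoeff
    rw [Nat.factorial_succ]
    push_cast
    rw [pow_succ]
    field_simp
    linear_combination -2 * h

/-- Matches the coefficients `Ring.choose (a + n - 1) n` of the binomial series of `(1 - z)^(-a)` at
`a = 1/2`. -/
lemma choose_half_eq (n : ℕ) : Ring.choose ((1 / 2 : ℝ) + n - 1) n = invSqrtCoeff n := by
  have h := Ring.factorial_nsmul_multichoose_eq_ascPochhammer (1 / 2 : ℝ) n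
  rw [← Polynomial.ascPochhammer_smeval_cast ℝ, ← Polynomial.eval_eq_smeval,
    ascPochhammer_half_eq, nsmul_eq_mul] at h
  rw [← Ring.multichoose_eq]
  exact mul_left_cancel₀ (by positivity) h

lemma hasSum_invSqrt {z : ℝ} (hz : |z| < 1) :
    HasSum (fun n => invSqrtCoeff n * z ^ n) (1 / Real.sqrt (1 - z)) := by
  have h := Real.one_div_one_sub_rpow_hasFPowerSeriesOnBall_zero (1 / 2)
  have := h.hasSum (y := z) (by simpa [enorm_eq_nnnorm, ← NNReal.coe_lt_coe] using hz)
  simp only [zero_add, FormalMultilinearSeries.ofScalars_apply_eq, choose_half_eq,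
    smul_eq_mul] at this
  simpa [Real.sqrt_eq_rpow] using this

lemma summable_invSqrt {z : ℝ} (hz : |z| < 1) :
    Summable (fun n => invSqrtCoeff n * |z| ^ n) :=
  (hasSum_invSqrt (z := |z|) (by simpa using hz)).summable

/-! ### Bessel functions and their Laplace transforms -/

/-- The power series `∑ (-σ)^k / (k!)² (x / 2)^(2 k)`: `J₀` for `σ = 1` and `I₀` for `σ = -1`. -/
def bessel (σ x : ℝ) : ℝ := ∑' k : ℕ, (-σ) ^ k / (k.factorial : ℝ) ^ 2 * (x / 2) ^ (2 * k)

lemma bessel_one : bessel 1 = besselJ0 := rfl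

lemma bessel_neg_one : bessel (-1) = besselI0 := by
  funext x
  simp [bessel, besselI0]

/-- Since `(2k)! ≤ 4^k (k!)²`, the series is dominated by that of `cosh`, which yields both the
growth bound and continuity. -/
lemma norm_bessel_term_le {σ : ℝ} (hσ : |σ| ≤ 1) (x : ℝ) (k : ℕ) :
    ‖(-σ) ^ k / (k.factorial : ℝ) ^ 2 * (x / 2) ^ (2 * k)‖
      ≤ |x| ^ (2 * k) / ((2 * k).factorial : ℝ) := by
  have h1 := invSqrtCoeff_le_one k
  rw [invSqrtCoeff_eq_factorial, div_le_one (by positivity)] at h1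
  rw [norm_mul, norm_div, norm_pow, norm_neg, norm_pow, norm_pow, norm_div]
  simp only [Real.norm_eq_abs, abs_of_nonneg (Nat.cast_nonneg (α := ℝ) _), abs_two]
  have h2 : |σ| ^ k ≤ 1 := pow_le_one₀ (abs_nonneg _) hσ
  rw [div_pow, pow_mul 2, div_mul_div_comm, show (2 : ℝ) ^ 2 = 4 by norm_num]
  gcongr
  · exact mul_le_of_le_one_left (by positivity) h2
  · linarith

lemma abs_bessel_le {σ : ℝ} (hσ : |σ| ≤ 1) (x : ℝ) : |bessel σ x| ≤ Real.exp |x| := by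
  have h : ‖bessel σ x‖ ≤ Real.cosh |x| :=
    tsum_of_norm_bounded (Real.hasSum_cosh |x|) (norm_bessel_term_le hσ x)
  refine h.trans ?_
  rw [Real.cosh_eq]
  have : Real.exp (-|x|) ≤ Real.exp |x| := Real.exp_le_exp.2 (by linarith [abs_nonneg x])
  linarith

lemma continuous_bessel {σ : ℝ} (hσ : |σ| ≤ 1) : Continuous (bessel σ) := by
  rw [continuous_iff_continuousAt]
  intro x
  have h : ContinuousOn (bessel σ) (Ioo (x - 1) (x + 1)) := by
    change ContinuousOn (fun y => ∑' k : ℕ, _) _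
    refine continuousOn_tsum
      (f := fun (k : ℕ) (y : ℝ) => (-σ) ^ k / (k.factorial : ℝ) ^ 2 * (y / 2) ^ (2 * k))
      (fun k => Continuous.continuousOn (by fun_prop))
      (Real.hasSum_cosh (|x| + 1)).summable fun k y hy => ?_
    refine (norm_bessel_term_le hσ y k).trans ?_
    have : |y| ≤ |x| + 1 := by
      have : |y - x| ≤ 1 := abs_le.2 ⟨by linarith [hy.1], by linarith [hy.2]⟩
      have := abs_add_le (y - x) x
      rw [sub_add_cancel] at this
      linarith
    gcongr
  exact h.continuousAt (Ioo_mem_nhds (by linarith) (by linarith))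

lemma integral_pow_mul_exp_neg {s : ℝ} (hs : 0 < s) (n : ℕ) :
    ∫ t in Ioi (0 : ℝ), t ^ n * Real.exp (-(s * t)) = n.factorial / s ^ (n + 1) := by
  have h := Real.integral_rpow_mul_exp_neg_mul_Ioi (a := n + 1) (r := s) (by positivity) hs
  rw [Real.Gamma_nat_eq_factorial] at h
  simp only [add_sub_cancel_right, Real.rpow_natCast] at h
  rw [h]
  norm_cast
  rw [one_div, inv_pow]
  ring

lemma integrableOn_pow_mul_exp_neg {s : ℝ} (hs : 0 < s) (n : ℕ) :
    IntegrableOn (fun t : ℝ => t ^ n * Real.exp (-(s * t))) (Ioi 0) := by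
  -- A non-integrable function would have integral `0` by convention.
  refine Integrable.of_integral_ne_zero ?_
  rw [integral_pow_mul_exp_neg hs]
  positivity

/-- The Laplace transform of `t ↦ J₀(x t)`, respectively `t ↦ I₀(x t)`. -/
lemma laplace_bessel {σ s x : ℝ} (hσ : |σ| ≤ 1) (hx : 0 ≤ x) (hxs : x < s) :
    ∫ t in Ioi (0 : ℝ), Real.exp (-(s * t)) * bessel σ (t * x)
      = 1 / Real.sqrt (s ^ 2 + σ * x ^ 2) := by
  have hs : 0 < s := hx.trans_lt hxs
  set F : ℕ → ℝ → ℝ := fun k t =>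
    Real.exp (-(s * t)) * ((-σ) ^ k / (k.factorial : ℝ) ^ 2 * (t * x / 2) ^ (2 * k)) with hF
  have hF' : ∀ k, F k = fun t => ((-σ) ^ k / (k.factorial : ℝ) ^ 2 * (x / 2) ^ (2 * k)) *
      (t ^ (2 * k) * Real.exp (-(s * t))) := by
    intro k; funext t; simp only [hF]; rw [mul_div_assoc, mul_pow]; ring
  -- Termwise integration produces `(2k)!/(k!)²`, hence central binomial coefficients. The identity
  -- is used with `c = -σ` for the values and `c = |σ|` for the norms.
  have key : ∀ (c : ℝ) (k : ℕ), c ^ k / (k.factorial : ℝ) ^ 2 * (x / 2) ^ (2 * k) *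
      ((2 * k).factorial / s ^ (2 * k + 1)) = 1 / s * (invSqrtCoeff k * (c * x ^ 2 / s ^ 2) ^ k) := by
    intro c k
    rw [invSqrtCoeff_eq_factorial, div_pow, div_pow, mul_pow, ← pow_mul, ← pow_mul, pow_mul 2,
      pow_succ s (2 * k)]
    norm_num
    field_simp
  have hratio : x ^ 2 / s ^ 2 < 1 := by
    rw [div_lt_one (by positivity)]; gcongr
  have hbnd : |(-σ) * x ^ 2 / s ^ 2| < 1 := by
    rw [abs_div, abs_mul, abs_neg, abs_of_nonneg (sq_nonneg x), abs_of_nonneg (sq_nonneg s),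
      mul_div_assoc]
    exact (mul_le_of_le_one_left (by positivity) hσ).trans_lt hratio
  have hint : ∀ k, IntegrableOn (F k) (Ioi 0) := fun k => by
    rw [hF']; exact (integrableOn_pow_mul_exp_neg hs _).const_mul _
  have hnorm : ∀ k, ∫ t in Ioi (0 : ℝ), ‖F k t‖ =
      1 / s * (invSqrtCoeff k * |(-σ) * x ^ 2 / s ^ 2| ^ k) := by
    intro k
    have : ∀ t ∈ Ioi (0 : ℝ), ‖F k t‖ = (|σ| ^ k / (k.factorial : ℝ) ^ 2 * (x / 2) ^ (2 * k)) *
      (t ^ (2 * k) * Real.exp (-(s * t))) := by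
      intro t ht
      have ht : 0 < t := ht
      rw [hF', Real.norm_eq_abs, abs_mul, abs_mul, abs_div, abs_pow (-σ), abs_neg,
        abs_of_nonneg (by positivity : 0 ≤ (k.factorial : ℝ) ^ 2),
        abs_of_nonneg (by positivity : 0 ≤ (x / 2) ^ (2 * k)),
        abs_of_nonneg (by positivity : 0 ≤ t ^ (2 * k) * Real.exp (-(s * t)))]
    rw [setIntegral_congr_fun measurableSet_Ioi this, integral_const_mul,
      integral_pow_mul_exp_neg hs, key, abs_div, abs_mul, abs_neg, abs_of_nonneg (sq_nonneg x),
      abs_of_nonneg (sq_nonneg s)]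
  have h := hasSum_integral_of_summable_integral_norm hint
    (by simp_rw [hnorm]; exact (summable_invSqrt hbnd).mul_left _)
  have h2 : HasSum (fun k => ∫ t in Ioi (0 : ℝ), F k t)
      (1 / s * (1 / Real.sqrt (1 - (-σ) * x ^ 2 / s ^ 2))) := by
    have hk : ∀ k, ∫ t in Ioi (0 : ℝ), F k t =
        1 / s * (invSqrtCoeff k * ((-σ) * x ^ 2 / s ^ 2) ^ k) := fun k => by
      rw [hF', integral_const_mul, integral_pow_mul_exp_neg hs, key]
    simp_rw [hk]
    exact (hasSum_invSqrt hbnd).mul_left (1 / s)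
  have h3 := h.unique h2
  simp only [hF, tsum_mul_left] at h3
  change ∫ t in Ioi (0 : ℝ), Real.exp (-(s * t)) * bessel σ (t * x) = _ at h3
  rw [h3, show s ^ 2 + σ * x ^ 2 = s ^ 2 * (1 - -σ * x ^ 2 / s ^ 2) by field_simp; ring,
    Real.sqrt_mul (by positivity), Real.sqrt_sq hs.le, one_div_mul_one_div_rev]
  ring

/-! ### Laplace transforms of Hankel transforms, by Fubini -/

lemma integrableOn_hankel {σ C : ℝ} (hσ : |σ| ≤ 1) {f : ℝ → ℝ} (hf : Measurable f)
    (hC : ∀ x, |f x| ≤ C) (hsupp : ∀ x, 1 ≤ x → f x = 0) (r : ℝ) :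
    IntegrableOn (fun t => t * f t * bessel σ (r * t)) (Ioi 0) := by
  have hC0 : 0 ≤ C := (abs_nonneg _).trans (hC 0)
  have h : IntegrableOn (fun t => t * f t * bessel σ (r * t)) (Ioo 0 1) := by
    refine Measure.integrableOn_of_bounded (M := 1 * C * Real.exp |r|) (by simp) ?_ ?_
    · exact ((measurable_id.mul hf).mul
        ((continuous_bessel hσ).measurable.comp (measurable_const_mul r))).aestronglyMeasurable
    · refine (ae_restrict_iff' measurableSet_Ioo).2 (.of_forall fun t ht => ?_)
      rw [norm_mul, norm_mul]
      have h1 : |t| ≤ 1 := by rw [abs_of_pos ht.1]; exact ht.2.le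
      have h2 : |bessel σ (r * t)| ≤ Real.exp |r| := by
        refine (abs_bessel_le hσ _).trans (Real.exp_le_exp.2 ?_)
        rw [abs_mul]
        exact mul_le_of_le_one_right (abs_nonneg _) h1
      simp only [Real.norm_eq_abs]
      gcongr
      exact hC t
  refine h.of_forall_sdiff_eq_zero measurableSet_Ioi fun t ht => ?_
  have : 1 ≤ t := by
    by_contra hlt
    exact ht.2 ⟨ht.1, not_le.1 hlt⟩
  simp [hsupp t this]

/-- On the support `x < 1` the kernel is at most `e^t`, which `e^{-st}` absorbs because `s > 1`. -/
lemma integrable_laplace_hankel {σ C s : ℝ} (hσ : |σ| ≤ 1) (hs : 1 < s) {f : ℝ → ℝ}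
    (hf : Measurable f) (hC : ∀ x, |f x| ≤ C) (hsupp : ∀ x, 1 ≤ x → f x = 0) :
    Integrable (fun p : ℝ × ℝ => Real.exp (-(s * p.1)) * (p.2 * f p.2 * bessel σ (p.1 * p.2)))
      ((volume.restrict (Ioi 0)).prod (volume.restrict (Ioi 0))) := by
  have hC0 : 0 ≤ C := (abs_nonneg _).trans (hC 0)
  have h1 : IntegrableOn (fun t : ℝ => Real.exp (-((s - 1) * t))) (Ioi 0) := by
    simpa using integrableOn_pow_mul_exp_neg (sub_pos.2 hs) 0
  have h2 : IntegrableOn ((Iio 1).indicator fun _ : ℝ => C) (Ioi 0) := by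
    rw [IntegrableOn, integrable_indicator_iff measurableSet_Iio, IntegrableOn,
      Measure.restrict_restrict measurableSet_Iio, Iio_inter_Ioi]
    exact integrableOn_const (by simp)
  refine (h1.mul_prod h2).mono' ?_ ?_
  · have hb : Measurable (bessel σ) := (continuous_bessel hσ).measurable
    exact Measurable.aestronglyMeasurable (by fun_prop)
  · rw [Measure.prod_restrict]
    refine (ae_restrict_iff' (measurableSet_Ioi.prod measurableSet_Ioi)).2
      (.of_forall fun p hp => ?_)
    obtain ⟨t, x⟩ := p
    obtain ⟨ht, hx⟩ : 0 < t ∧ 0 < x := hp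
    by_cases hx1 : x < 1
    · simp only [norm_mul, Real.norm_eq_abs, indicator_of_mem (mem_Iio.2 hx1), Real.abs_exp,
        abs_of_pos hx]
      have hb : |bessel σ (t * x)| ≤ Real.exp t := by
        refine (abs_bessel_le hσ _).trans (Real.exp_le_exp.2 ?_)
        rw [abs_of_pos (mul_pos ht hx)]
        exact mul_le_of_le_one_right ht.le hx1.le
      calc Real.exp (-(s * t)) * (x * |f x| * |bessel σ (t * x)|)
          ≤ Real.exp (-(s * t)) * (1 * C * Real.exp t) := by
            gcongr
            exact hC x
        _ = Real.exp (-((s - 1) * t)) * C := by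
            rw [show -((s - 1) * t) = -(s * t) + t by ring, Real.exp_add]
            ring
    · simp [hsupp x (not_lt.1 hx1), hx1]

lemma laplaceConverges_hankel {σ C s : ℝ} (hσ : |σ| ≤ 1) (hs : 1 < s) {f : ℝ → ℝ}
    (hf : Measurable f) (hC : ∀ x, |f x| ≤ C) (hsupp : ∀ x, 1 ≤ x → f x = 0) :
    LaplaceConverges (fun r => ∫ t in Ioi (0 : ℝ), t * f t * bessel σ (r * t)) s := by
  have h := (integrable_laplace_hankel hσ hs hf hC hsupp).integral_prod_left
  simpa only [LaplaceConverges, IntegrableOn, integral_const_mul] using h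

lemma laplace_hankel {σ C s : ℝ} (hσ : |σ| ≤ 1) (hs : 1 < s) {f : ℝ → ℝ}
    (hf : Measurable f) (hC : ∀ x, |f x| ≤ C) (hsupp : ∀ x, 1 ≤ x → f x = 0) :
    laplace (fun r => ∫ t in Ioi (0 : ℝ), t * f t * bessel σ (r * t)) s
      = ∫ x in Ioi (0 : ℝ), x * f x * (1 / Real.sqrt (s ^ 2 + σ * x ^ 2)) := by
  have h := integral_integral_swap
    (f := fun t x => Real.exp (-(s * t)) * (x * f x * bessel σ (t * x)))
    (integrable_laplace_hankel hσ hs hf hC hsupp)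
  simp only [integral_const_mul] at h
  rw [laplace, h]
  refine setIntegral_congr_fun measurableSet_Ioi fun x hx => ?_
  -- The inner Laplace transform is evaluated only for `x < s`; from `x = 1` on, `f x = 0`.
  rcases lt_or_ge x 1 with hx1 | hx1
  · rw [← laplace_bessel hσ (le_of_lt hx) (hx1.trans hs), ← integral_const_mul]
    congr 1
    funext t
    ring
  · simp [hsupp x hx1]

/-! ### The inverse function and the substitution `q(s) = ± x²` -/

namespace Admissible

variable {q : ℝ → ℝ}

lemma map_zero_lt_map_one (hq : Admissible q) : q 0 < q 1 :=
  hq.strictMonoOn (by simp) (by simp) one_pos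

lemma continuousOn (hq : Admissible q) : ContinuousOn q (Icc 0 1) := hq.contDiffOn.continuousOn

lemma inverse_apply (hq : Admissible q) {t : ℝ} (ht : t ∈ Icc (0 : ℝ) 1) : inverse q (q t) = t :=
  hq.strictMonoOn.injOn.leftInvOn_invFunOn ht

lemma exists_eq (hq : Admissible q) {y : ℝ} (hy : y ∈ Ioo (q 0) (q 1)) :
    ∃ t ∈ Ioo (0 : ℝ) 1, q t = y :=
  intermediate_value_Ioo zero_le_one hq.continuousOn hy

lemma map_mem_Ioo (hq : Admissible q) {t : ℝ} (ht : t ∈ Ioo (0 : ℝ) 1) :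
    q t ∈ Ioo (q 0) (q 1) :=
  ⟨hq.strictMonoOn (by simp) (Ioo_subset_Icc_self ht) ht.1,
    hq.strictMonoOn (Ioo_subset_Icc_self ht) (by simp) ht.2⟩

lemma differentiableAt_inverse (hq : Admissible q) {y : ℝ} (hy : y ∈ Ioo (q 0) (q 1)) :
    DifferentiableAt ℝ (inverse q) y :=
  (hq.contDiffOn_inverse.differentiableOn one_ne_zero y
    (Ioo_subset_Icc_self hy)).differentiableAt (Icc_mem_nhds hy.1 hy.2)

lemma monotoneOn_inverse (hq : Admissible q) : MonotoneOn (inverse q) (Ioo (q 0) (q 1)) := by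
  intro y hy z hz hyz
  obtain ⟨t, ht, rfl⟩ := hq.exists_eq hy
  obtain ⟨u, hu, rfl⟩ := hq.exists_eq hz
  rw [hq.inverse_apply (Ioo_subset_Icc_self ht), hq.inverse_apply (Ioo_subset_Icc_self hu)]
  exact (hq.strictMonoOn.le_iff_le (Ioo_subset_Icc_self ht) (Ioo_subset_Icc_self hu)).1 hyz

lemma deriv_inverse_nonneg (hq : Admissible q) {y : ℝ} (hy : y ∈ Ioo (q 0) (q 1)) :
    0 ≤ deriv (inverse q) y := by
  rw [← derivWithin_of_isOpen isOpen_Ioo hy]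
  exact hq.monotoneOn_inverse.derivWithin_nonneg

/-- The one-sided derivative is continuous on the compact interval, and it agrees with `deriv` in
the interior. -/
lemma exists_inverseDensity_le (hq : Admissible q) : ∃ C, ∀ y, |inverseDensity q y| ≤ C := by
  have hc : ContinuousOn (derivWithin (inverse q) (Icc (q 0) (q 1))) (Icc (q 0) (q 1)) :=
    hq.contDiffOn_inverse.continuousOn_derivWithin
      (uniqueDiffOn_Icc hq.map_zero_lt_map_one) le_rfl
  obtain ⟨C, hC⟩ := isCompact_Icc.exists_bound_of_continuousOn hc
  refine ⟨C, fun y => ?_⟩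
  by_cases hy : y ∈ Ioo (q 0) (q 1)
  · have := hC y (Ioo_subset_Icc_self hy)
    rw [derivWithin_of_mem_nhds (Icc_mem_nhds hy.1 hy.2), Real.norm_eq_abs] at this
    rwa [inverseDensity, indicator_of_mem hy]
  · rw [inverseDensity, indicator_of_notMem hy, abs_zero]
    exact (norm_nonneg _).trans (hC (q 0) ⟨le_rfl, hq.map_zero_lt_map_one.le⟩)

end Admissible

lemma measurable_inverseDensity (q : ℝ → ℝ) : Measurable (inverseDensity q) :=
  (measurable_deriv _).indicator measurableSet_Ioo

/-- `x ↦ 1_{(q 0, q 1)}(σ x²) (q⁻¹)'(σ x²)`, that is `Q` for `σ = 1` and `Q⁻` for `σ = -1`. -/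
def signedQ (σ : ℝ) (q : ℝ → ℝ) (x : ℝ) : ℝ := inverseDensity q (σ * x ^ 2)

lemma signedQ_one (q : ℝ → ℝ) : signedQ 1 q = Q q := by
  funext x; simp [signedQ, Q]

lemma signedQ_neg_one (q : ℝ → ℝ) : signedQ (-1) q = Qneg q := by
  funext x; simp [signedQ, Qneg]

lemma measurable_signedQ (σ : ℝ) (q : ℝ → ℝ) : Measurable (signedQ σ q) :=
  (measurable_inverseDensity q).comp (by fun_prop)

lemma Admissible.signedQ_eq_zero {q : ℝ → ℝ} (hq : Admissible q) {σ : ℝ} (hσ : |σ| = 1) {x : ℝ}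
    (hx : 1 ≤ x) : signedQ σ q x = 0 := by
  refine indicator_of_notMem (fun h => ?_) _
  have h0 := abs_le.1 (hq.abs_le_one 0 (by simp))
  have h1 := abs_le.1 (hq.abs_le_one 1 (by simp))
  rcases (abs_eq zero_le_one).1 hσ with rfl | rfl <;> nlinarith [h.1, h.2]

/-- The substitution `s = q⁻¹(σ x²)`. -/
lemma Admissible.integral_signedQ {q : ℝ → ℝ} (hq : Admissible q) {σ : ℝ} (hσ : |σ| = 1)
    (F : ℝ → ℝ) :
    2 * ∫ x in Ioi (0 : ℝ), x * signedQ σ q x * F (σ * x ^ 2)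
      = ∫ s in {s | s ∈ Ioo (0 : ℝ) 1 ∧ 0 < σ * q s}, F (q s) := by
  have hσσ : σ * σ = 1 := by rw [← abs_mul_abs_self, hσ, one_mul]
  set A : Set ℝ := {x | x ∈ Ioi (0 : ℝ) ∧ σ * x ^ 2 ∈ Ioo (q 0) (q 1)}
  have hAm : MeasurableSet A :=
    measurableSet_Ioi.inter ((by fun_prop : Measurable fun x : ℝ => σ * x ^ 2) measurableSet_Ioo)
  have himage : (fun x => inverse q (σ * x ^ 2)) '' A
      = {s | s ∈ Ioo (0 : ℝ) 1 ∧ 0 < σ * q s} := by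
    ext s
    constructor
    · rintro ⟨x, ⟨hx, hy⟩, rfl⟩
      have hx : 0 < x := hx
      obtain ⟨t, ht, hty⟩ := hq.exists_eq hy
      simp only [← hty, hq.inverse_apply (Ioo_subset_Icc_self ht)]
      refine ⟨ht, ?_⟩
      rw [hty, ← mul_assoc, hσσ, one_mul]
      positivity
    · rintro ⟨hs, hpos⟩
      have hsq : σ * Real.sqrt (σ * q s) ^ 2 = q s := by
        rw [Real.sq_sqrt hpos.le, ← mul_assoc, hσσ, one_mul]
      refine ⟨Real.sqrt (σ * q s), ⟨Real.sqrt_pos.2 hpos, ?_⟩, ?_⟩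
      · rw [hsq]; exact hq.map_mem_Ioo hs
      · simp only [hsq, hq.inverse_apply (Ioo_subset_Icc_self hs)]
  have hinj : InjOn (fun x => inverse q (σ * x ^ 2)) A := by
    rintro x ⟨hx, hxy⟩ z ⟨hz, hzy⟩ h
    obtain ⟨t, ht, hty⟩ := hq.exists_eq hxy
    obtain ⟨u, hu, huy⟩ := hq.exists_eq hzy
    simp only [← hty, ← huy, hq.inverse_apply (Ioo_subset_Icc_self ht),
      hq.inverse_apply (Ioo_subset_Icc_self hu)] at h
    rw [h, huy] at hty
    have h2 : z ^ 2 = x ^ 2 := by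
      have := congrArg (σ * ·) hty
      simpa only [← mul_assoc, hσσ, one_mul] using this
    exact ((pow_left_inj₀ (le_of_lt hz) (le_of_lt hx) two_ne_zero).1 h2).symm
  have hderiv : ∀ x ∈ A, HasDerivWithinAt (fun x => inverse q (σ * x ^ 2))
      (deriv (inverse q) (σ * x ^ 2) * (σ * (2 * x))) A x := by
    rintro x ⟨-, hxy⟩
    have h1 : HasDerivAt (fun x : ℝ => σ * x ^ 2) (σ * (2 * x)) x := by
      simpa using (hasDerivAt_pow 2 x).const_mul σ
    exact ((hq.differentiableAt_inverse hxy).hasDerivAt.comp x h1).hasDerivWithinAt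
  -- This formula needs no integrability, so `F` is arbitrary. The Jacobian is `2 x (q⁻¹)'(σ x²)`,
  -- as `q⁻¹` is increasing and `|σ| = 1`.
  have hchange := integral_image_eq_integral_abs_deriv_smul hAm hderiv hinj (fun s => F (q s))
  rw [himage] at hchange
  rw [hchange, ← integral_const_mul]
  have hzero : ∀ x ∈ Ioi (0 : ℝ) \ A, 2 * (x * signedQ σ q x * F (σ * x ^ 2)) = 0 := by
    rintro x ⟨hx, hxA⟩
    have : signedQ σ q x = 0 := indicator_of_notMem (fun h => hxA ⟨hx, h⟩) _
    simp [this]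
  rw [setIntegral_eq_of_subset_of_forall_sdiff_eq_zero measurableSet_Ioi
    (fun x hx => hx.1 : A ⊆ Ioi 0) hzero]
  refine setIntegral_congr_fun hAm fun x hx => ?_
  obtain ⟨hx0, hxy⟩ := hx
  have hx0 : 0 < x := hx0
  obtain ⟨t, ht, hty⟩ := hq.exists_eq hxy
  have hqt : q (inverse q (σ * x ^ 2)) = σ * x ^ 2 := by
    rw [← hty, hq.inverse_apply (Ioo_subset_Icc_self ht)]
  simp only [hqt, smul_eq_mul]
  rw [abs_mul, abs_mul, hσ, abs_of_nonneg (hq.deriv_inverse_nonneg hxy),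
    abs_of_pos (by positivity : 0 < 2 * x), signedQ, inverseDensity, indicator_of_mem hxy]
  ring

/-- Splitting an integral over `q` into the parts where `q` is positive and negative. -/
lemma Admissible.integral_comp_eq {q : ℝ → ℝ} (hq : Admissible q) {F : ℝ → ℝ}
    (hF : IntegrableOn (fun s => F (q s)) (Icc 0 1)) :
    ∫ s in (0 : ℝ)..1, F (q s) = 2 * ((∫ x in Ioi (0 : ℝ), x * signedQ 1 q x * F (1 * x ^ 2))
      + ∫ x in Ioi (0 : ℝ), x * signedQ (-1) q x * F (-1 * x ^ 2)) := by
  rw [mul_add, hq.integral_signedQ (by simp), hq.integral_signedQ (by simp)]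
  have hmono : StrictMonoOn q (Ioo 0 1) := hq.strictMonoOn.mono Ioo_subset_Icc_self
  -- By monotonicity, preimages of intervals are intervals.
  have hconn : ∀ T : Set ℝ, T.OrdConnected → MeasurableSet {s | s ∈ Ioo (0 : ℝ) 1 ∧ q s ∈ T} := by
    intro T hT
    refine OrdConnected.measurableSet (ordConnected_def.2 fun x hx y hy z hz => ?_)
    have hz' : z ∈ Ioo (0 : ℝ) 1 := ⟨hx.1.1.trans_le hz.1, hz.2.trans_lt hy.1.2⟩
    exact ⟨hz', hT.out hx.2 hy.2 ⟨(hmono.le_iff_le hx.1 hz').2 hz.1,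
      (hmono.le_iff_le hz' hy.1).2 hz.2⟩⟩
  have hp : MeasurableSet {s | s ∈ Ioo (0 : ℝ) 1 ∧ 0 < 1 * q s} := by
    simpa using hconn (Ioi 0) ordConnected_Ioi
  have hn : MeasurableSet {s | s ∈ Ioo (0 : ℝ) 1 ∧ 0 < -1 * q s} := by
    simpa using hconn (Iio 0) ordConnected_Iio
  have hdisj : Disjoint {s | s ∈ Ioo (0 : ℝ) 1 ∧ 0 < 1 * q s}
      {s | s ∈ Ioo (0 : ℝ) 1 ∧ 0 < -1 * q s} := by
    rw [Set.disjoint_left]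
    rintro s ⟨-, h1⟩ ⟨-, h2⟩
    linarith
  have hF' := hF.mono_set Ioo_subset_Icc_self
  rw [← setIntegral_union hdisj hn (hF'.mono_set fun s hs => hs.1) (hF'.mono_set fun s hs => hs.1),
    intervalIntegral.integral_of_le zero_le_one, integral_Ioc_eq_integral_Ioo]
  refine setIntegral_congr_set ?_
  -- The zero set, missed by both signs, has at most one point.
  have hsub : {s | s ∈ Ioo (0 : ℝ) 1 ∧ q s = 0}.Subsingleton := fun s hs t ht =>
    hmono.injOn hs.1 ht.1 (hs.2.trans ht.2.symm)
  have hae : ∀ᵐ s : ℝ, s ∉ {s | s ∈ Ioo (0 : ℝ) 1 ∧ q s = 0} :=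
    measure_eq_zero_iff_ae_notMem.1 (hsub.measure_zero _)
  filter_upwards [hae] with s hs
  refine propext ⟨fun h => ?_, fun h => h.elim (·.1) (·.1)⟩
  rcases lt_trichotomy (q s) 0 with h0 | h0 | h0
  · exact Or.inr ⟨h, by linarith⟩
  · exact absurd ⟨h, h0⟩ hs
  · exact Or.inl ⟨h, by linarith⟩

/-! ### Differentiation under the integral -/

lemma hasDerivAt_integral_sqrt {X : Type*} [MeasurableSpace X] {μ : Measure X} [IsFiniteMeasure μ]
    {g : X → ℝ} (hg : AEMeasurable g μ) (hb : ∀ᵐ x ∂μ, |g x| ≤ 1) {a l : ℝ} (ha : 0 ≤ a)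
    (hl : 0 < l) (hal : a < l ^ 2) :
    HasDerivAt (fun l => ∫ x, Real.sqrt (l ^ 2 + a * g x) ∂μ)
      (∫ x, l / Real.sqrt (l ^ 2 + a * g x) ∂μ) l := by
  -- With `m²` midway between `a` and `l²`, the radicand is at least `m² - a > 0` throughout a
  -- neighbourhood of `l`.
  set m := Real.sqrt ((a + l ^ 2) / 2)
  have hm2 : m ^ 2 = (a + l ^ 2) / 2 := Real.sq_sqrt (by positivity)
  have hm0 : 0 ≤ m := Real.sqrt_nonneg _
  have hml : m < l := lt_of_pow_lt_pow_left₀ 2 hl.le (by linarith)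
  have hlow : ∀ x ∈ Ioo m (l + 1), ∀ y : ℝ, |y| ≤ 1 → m ^ 2 - a ≤ x ^ 2 + a * y := by
    intro x hx y hy
    have : m ^ 2 ≤ x ^ 2 := by have := hx.1; gcongr
    nlinarith [(abs_le.1 hy).1]
  refine (hasDerivAt_integral_of_dominated_loc_of_deriv_le
    (F' := fun l x => l / Real.sqrt (l ^ 2 + a * g x))
    (bound := fun _ => (l + 1) / Real.sqrt (m ^ 2 - a))
    (Ioo_mem_nhds hml (lt_add_one l)) ?_ ?_ ?_ ?_ (integrable_const _) ?_).2
  · exact .of_forall fun x =>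
      (by fun_prop : AEMeasurable (fun y => Real.sqrt (x ^ 2 + a * g y)) μ).aestronglyMeasurable
  · refine Integrable.of_bound
      (by fun_prop : AEMeasurable (fun y => Real.sqrt (l ^ 2 + a * g y)) μ).aestronglyMeasurable
      (Real.sqrt (l ^ 2 + a)) ?_
    filter_upwards [hb] with y hy
    rw [Real.norm_eq_abs, abs_of_nonneg (Real.sqrt_nonneg _)]
    refine Real.sqrt_le_sqrt ?_
    nlinarith [(abs_le.1 hy).2]
  · exact (by fun_prop :
      AEMeasurable (fun y => l / Real.sqrt (l ^ 2 + a * g y)) μ).aestronglyMeasurable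
  · filter_upwards [hb] with y hy x hx
    have h := hlow x hx _ hy
    have hx0 : 0 ≤ x := hm0.trans hx.1.le
    have hpos : 0 < m ^ 2 - a := by linarith
    rw [Real.norm_eq_abs, abs_of_nonneg (by positivity)]
    gcongr
    exact hx.2.le
  · filter_upwards [hb] with y hy x hx
    have h := hlow x hx _ hy
    have h1 : HasDerivAt (fun x : ℝ => x ^ 2 + a * g y) (2 * x) x := by
      simpa using (hasDerivAt_pow 2 x).add_const (a * g y)
    have h2 := h1.sqrt (ne_of_gt (by linarith))
    rwa [mul_div_mul_left _ _ two_ne_zero] at h2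

/-! ### Measures on `[-1, 1]` determined by moments -/

section Moments

variable {ν : Measure ℝ}

/-- Stated over `RCLike` to serve the real series of `1/√(1 - z y)` and the complex series of the
characteristic function. -/
lemma hasSum_integral_pow {𝕜 : Type*} [RCLike 𝕜] [IsFiniteMeasure ν] (hν : ∀ᵐ y ∂ν, |y| ≤ 1)
    {b : ℕ → 𝕜} (hb : Summable fun n => ‖b n‖) {f : ℝ → 𝕜}
    (hf : ∀ y : ℝ, |y| ≤ 1 → HasSum (fun n => b n * (y : 𝕜) ^ n) (f y)) :
    HasSum (fun n => b n * ((∫ y, y ^ n ∂ν : ℝ) : 𝕜)) (∫ y, f y ∂ν) := by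
  have h := hasSum_integral_of_dominated_convergence (μ := ν)
    (F := fun n y => b n * (y : 𝕜) ^ n) (f := f) (fun n _ => ‖b n‖) ?_ ?_ ?_ ?_ ?_
  · refine h.congr_fun fun n => ?_
    rw [integral_const_mul, ← integral_ofReal]
    simp
  · intro n
    exact Continuous.aestronglyMeasurable (by fun_prop)
  · intro n
    filter_upwards [hν] with y hy
    rw [norm_mul, norm_pow, RCLike.norm_ofReal]
    exact mul_le_of_le_one_right (norm_nonneg _) (pow_le_one₀ (abs_nonneg _) hy)
  · exact .of_forall fun _ => hb
  · exact integrable_const _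
  · filter_upwards [hν] with y hy using hf y hy

lemma abs_moment_le_one [IsProbabilityMeasure ν] (hν : ∀ᵐ y ∂ν, |y| ≤ 1) (n : ℕ) :
    |∫ y, y ^ n ∂ν| ≤ 1 := by
  have := norm_integral_le_of_norm_le_const (μ := ν) (f := fun y => y ^ n) (C := 1) (by
    filter_upwards [hν] with y hy
    rw [norm_pow]
    exact pow_le_one₀ (abs_nonneg _) hy)
  simpa using this

/-- The power series of the generating function `z ↦ ∫ 1 / √(1 - z y) dν(y)`. -/
lemma hasFPowerSeriesOnBall_integral_invSqrt [IsProbabilityMeasure ν]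
    (hν : ∀ᵐ y ∂ν, |y| ≤ 1) :
    HasFPowerSeriesOnBall (fun z : ℝ => ∫ y, 1 / Real.sqrt (1 - z * y) ∂ν)
      (.ofScalars ℝ fun n => invSqrtCoeff n * ∫ y, y ^ n ∂ν) 0 1 where
  r_le := by
    refine ENNReal.le_of_forall_nnreal_lt fun r hr => ?_
    have hr : (r : ℝ) < 1 := by exact_mod_cast hr
    refine FormalMultilinearSeries.le_radius_of_summable_norm _ ?_
    refine Summable.of_nonneg_of_le (fun n => by positivity) (fun n => ?_)
      (summable_geometric_of_lt_one r.2 hr)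
    rw [FormalMultilinearSeries.ofScalars_norm, norm_mul]
    refine mul_le_of_le_one_left (by positivity) ?_
    refine mul_le_one₀ ?_ (norm_nonneg _) (abs_moment_le_one hν n)
    rw [Real.norm_eq_abs, abs_of_pos (invSqrtCoeff_pos n)]
    exact invSqrtCoeff_le_one n
  r_pos := one_pos
  hasSum := by
    intro z hz
    have hz : |z| < 1 := by simpa [enorm_eq_nnnorm, ← NNReal.coe_lt_coe] using hz
    have h := hasSum_integral_pow (𝕜 := ℝ) hν (b := fun n => invSqrtCoeff n * z ^ n)
      (f := fun y => 1 / Real.sqrt (1 - z * y)) ?_ ?_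
    · simp only [FormalMultilinearSeries.ofScalars_apply_eq, smul_eq_mul, zero_add]
      refine h.congr_fun fun n => ?_
      simp only [RCLike.ofReal_real_eq_id, id_eq]
      ring
    · simpa [abs_of_pos (invSqrtCoeff_pos _)] using summable_invSqrt hz
    · intro y hy
      have hzy : |z * y| < 1 := by
        rw [abs_mul]
        exact (mul_le_of_le_one_right (abs_nonneg _) hy).trans_lt hz
      refine (hasSum_invSqrt hzy).congr_fun fun n => ?_
      simp only [RCLike.ofReal_real_eq_id, id_eq, mul_pow]
      ring

lemma charFun_eq_of_moments {ν₁ ν₂ : Measure ℝ} [IsFiniteMeasure ν₁] [IsFiniteMeasure ν₂]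
    (h₁ : ∀ᵐ y ∂ν₁, |y| ≤ 1) (h₂ : ∀ᵐ y ∂ν₂, |y| ≤ 1)
    (hm : ∀ n : ℕ, ∫ y, y ^ n ∂ν₁ = ∫ y, y ^ n ∂ν₂) : charFun ν₁ = charFun ν₂ := by
  funext t
  rw [charFun_apply_real, charFun_apply_real]
  have hs : ∀ y : ℝ, |y| ≤ 1 → HasSum
      (fun n : ℕ => ((t * Complex.I) ^ n / (n.factorial : ℂ)) * (y : ℂ) ^ n)
      (Complex.exp (t * y * Complex.I)) := by
    intro y _
    rw [show (t * y * Complex.I : ℂ) = t * Complex.I * y by ring, Complex.exp_eq_exp_ℂ]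
    refine (NormedSpace.expSeries_div_hasSum_exp _).congr_fun fun n => ?_
    rw [mul_pow _ (y : ℂ)]
    ring
  have hb : Summable (fun n : ℕ => ‖(t * Complex.I) ^ n / (n.factorial : ℂ)‖) :=
    NormedSpace.norm_expSeries_div_summable _
  have e₁ := hasSum_integral_pow h₁ hb hs
  have e₂ := hasSum_integral_pow h₂ hb hs
  simp only [hm] at e₁
  exact e₁.unique e₂

/-- A probability measure on `[-1, 1]` is determined by its transform `c ↦ ∫ 1 / √(1 + c y)` on any
nontrivial interval. -/
lemma measure_ext_of_integral_invSqrt {ν₁ ν₂ : Measure ℝ} [IsProbabilityMeasure ν₁]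
    [IsProbabilityMeasure ν₂] (h₁ : ∀ᵐ y ∂ν₁, |y| ≤ 1) (h₂ : ∀ᵐ y ∂ν₂, |y| ≤ 1) {u v : ℝ}
    (hu : 0 ≤ u) (huv : u < v) (hv : v ≤ 1)
    (h : ∀ c ∈ Ioo u v, ∫ y, 1 / Real.sqrt (1 + c * y) ∂ν₁ = ∫ y, 1 / Real.sqrt (1 + c * y) ∂ν₂) :
    ν₁ = ν₂ := by
  have p₁ := hasFPowerSeriesOnBall_integral_invSqrt h₁
  have p₂ := hasFPowerSeriesOnBall_integral_invSqrt h₂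
  have hball : ∀ z : ℝ, z ∈ Metric.eball (0 : ℝ) 1 ↔ |z| < 1 := fun z => by
    simp [enorm_eq_nnnorm, ← NNReal.coe_lt_coe]
  have hz₀ : -((u + v) / 2) ∈ Metric.eball (0 : ℝ) 1 := by
    rw [hball, abs_neg, abs_of_nonneg (by linarith)]
    linarith
  have hpre : IsPreconnected (Metric.eball (0 : ℝ) 1) := by
    have : Metric.eball (0 : ℝ) 1 = Ioo (-1) 1 := by
      ext z; rw [hball, abs_lt, mem_Ioo]
    rw [this]
    exact isPreconnected_Ioo
  have hev : (fun z : ℝ => ∫ y, 1 / Real.sqrt (1 - z * y) ∂ν₁) =ᶠ[nhds (-((u + v) / 2))]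
      fun z => ∫ y, 1 / Real.sqrt (1 - z * y) ∂ν₂ := by
    filter_upwards [Ioo_mem_nhds (a := -v) (b := -u) (by linarith) (by linarith)] with z hz
    simpa [sub_eq_add_neg] using h (-z) ⟨by linarith [hz.2], by linarith [hz.1]⟩
  -- The identity theorem carries the agreement near `-(u + v)/2` to a neighbourhood of `0`, where
  -- coefficients can be compared.
  have heq := p₁.analyticOnNhd.eqOn_of_preconnected_of_eventuallyEq p₂.analyticOnNhd hpre hz₀ hev
  have hser := p₁.hasFPowerSeriesAt.eq_formalMultilinearSeries_of_eventually p₂.hasFPowerSeriesAt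
    (Filter.mem_of_superset (Metric.eball_mem_nhds 0 one_pos) heq)
  have hcoef := FormalMultilinearSeries.ofScalars_series_injective ℝ ℝ hser
  refine Measure.ext_of_charFun (charFun_eq_of_moments h₁ h₂ fun n => ?_)
  exact mul_left_cancel₀ (invSqrtCoeff_pos n).ne' (congrFun hcoef n)

end Moments

/-! ### Distributions, rearrangements and monotone functions -/

/-- The distribution of `q` under Lebesgue measure on `[0, 1]`. -/
def distribution (q : ℝ → ℝ) : Measure ℝ := (volume.restrict (Icc 0 1)).map q

lemma isProbabilityMeasure_distribution {q : ℝ → ℝ}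
    (hq : AEMeasurable q (volume.restrict (Icc 0 1))) :
    IsProbabilityMeasure (distribution q) := by
  have : IsProbabilityMeasure (volume.restrict (Icc (0 : ℝ) 1)) := ⟨by simp⟩
  exact Measure.isProbabilityMeasure_map hq

lemma ae_distribution_abs_le {q : ℝ → ℝ} (hq : AEMeasurable q (volume.restrict (Icc 0 1)))
    (hb : ∀ t ∈ Icc (0 : ℝ) 1, |q t| ≤ 1) : ∀ᵐ y ∂distribution q, |y| ≤ 1 := by
  rw [distribution, ae_map_iff hq (measurableSet_le measurable_abs measurable_const)]
  exact (ae_restrict_iff' measurableSet_Icc).2 (.of_forall hb)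

lemma integral_comp_eq_integral_distribution {q : ℝ → ℝ}
    (hq : AEMeasurable q (volume.restrict (Icc 0 1))) {F : ℝ → ℝ} (hF : Measurable F) :
    ∫ s in (0 : ℝ)..1, F (q s) = ∫ y, F y ∂distribution q := by
  rw [distribution, integral_map hq hF.aestronglyMeasurable,
    intervalIntegral.integral_of_le zero_le_one, integral_Icc_eq_integral_Ioc]

lemma distribution_Ioi {q : ℝ → ℝ} (hq : AEMeasurable q (volume.restrict (Icc 0 1))) (y : ℝ) :
    distribution q (Ioi y) = volume {t : ℝ | t ∈ Icc (0 : ℝ) 1 ∧ y < q t} := by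
  rw [distribution, Measure.map_apply_of_aemeasurable hq measurableSet_Ioi,
    Measure.restrict_apply' measurableSet_Icc, inter_comm]
  rfl

lemma distribution_eq_of_isRearrangement {q₁ q₂ : ℝ → ℝ}
    (hq₁ : AEMeasurable q₁ (volume.restrict (Icc 0 1)))
    (hq₂ : AEMeasurable q₂ (volume.restrict (Icc 0 1)))
    (hb₁ : ∀ t ∈ Icc (0 : ℝ) 1, |q₁ t| ≤ 1) (hb₂ : ∀ t ∈ Icc (0 : ℝ) 1, |q₂ t| ≤ 1)
    (h : IsRearrangement q₁ q₂) : distribution q₁ = distribution q₂ := by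
  have := isProbabilityMeasure_distribution hq₁
  have := isProbabilityMeasure_distribution hq₂
  refine ext_of_generate_finite _ ((borel_eq_generateFrom_Ioi ℝ) ▸ BorelSpace.measurable_eq)
    isPiSystem_Ioi ?_ (by simp)
  rintro _ ⟨y, rfl⟩
  rw [distribution_Ioi hq₁, distribution_Ioi hq₂]
  -- Outside `[-1, 1]` both superlevel sets are everything or both are empty.
  by_cases hy : y ∈ Icc (-1 : ℝ) 1
  · exact h y hy
  · congr 1
    ext t
    refine and_congr_right fun ht => ?_
    have h1 := abs_le.1 (hb₁ t ht)
    have h2 := abs_le.1 (hb₂ t ht)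
    rcases lt_or_ge y (-1) with hy1 | hy1
    · exact iff_of_true (by linarith) (by linarith)
    · have : 1 < y := by
        by_contra hle
        exact hy ⟨hy1, not_lt.1 hle⟩
      exact iff_of_false (by linarith) (by linarith)

lemma data_eq_of_isRearrangement {α η : ℝ} {q₁ q₂ : ℝ → ℝ}
    (hq₁ : AEMeasurable q₁ (volume.restrict (Icc 0 1)))
    (hq₂ : AEMeasurable q₂ (volume.restrict (Icc 0 1)))
    (hb₁ : ∀ t ∈ Icc (0 : ℝ) 1, |q₁ t| ≤ 1) (hb₂ : ∀ t ∈ Icc (0 : ℝ) 1, |q₂ t| ≤ 1)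
    (h : IsRearrangement q₁ q₂) : data α η q₁ = data α η q₂ := by
  funext l
  have hF : Measurable fun y : ℝ => Real.sqrt (1 + η ^ α / l ^ 2 * y) := by fun_prop
  exact (integral_comp_eq_integral_distribution hq₁ hF).trans
    ((distribution_eq_of_isRearrangement hq₁ hq₂ hb₁ hb₂ h) ▸
      (integral_comp_eq_integral_distribution hq₂ hF).symm)

namespace Admissible

variable {q q₁ q₂ : ℝ → ℝ}

lemma aemeasurable (hq : Admissible q) : AEMeasurable q (volume.restrict (Icc 0 1)) :=
  hq.continuousOn.aemeasurable measurableSet_Icc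

/-- A strictly increasing continuous function on `[0, 1]` is determined by its distribution. -/
lemma le_of_distribution_eq (hq₁ : Admissible q₁) (hq₂ : Admissible q₂)
    (h : distribution q₁ = distribution q₂) {t : ℝ} (ht : t ∈ Ioo (0 : ℝ) 1) : q₂ t ≤ q₁ t := by
  by_contra! hlt
  have hc : ContinuousAt q₂ t := hq₂.continuousOn.continuousAt (Icc_mem_nhds ht.1 ht.2)
  -- If `q₁ t < q₂ t`, continuity gives `u < t` with `q₁ t < q₂ u`. Then `{q₂ > q₁ t}` has measure
  -- at least `1 - u`, while `{q₁ > q₁ t}` has at most `1 - t`.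
  have hev : ∀ᶠ u in nhdsWithin t (Iio t), q₁ t < q₂ u ∧ u ∈ Ioo 0 t :=
    ((hc.eventually (lt_mem_nhds hlt)).filter_mono nhdsWithin_le_nhds).and
      (Ioo_mem_nhdsLT ht.1)
  obtain ⟨u, hu, hu0, hut⟩ := hev.exists
  have e := congrArg (· (Ioi (q₁ t))) h
  simp only [distribution_Ioi hq₁.aemeasurable, distribution_Ioi hq₂.aemeasurable] at e
  have hle : volume {s : ℝ | s ∈ Icc (0 : ℝ) 1 ∧ q₁ t < q₁ s} ≤ volume (Ioc t 1) :=
    measure_mono fun s hs =>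
      ⟨(hq₁.strictMonoOn.lt_iff_lt (Ioo_subset_Icc_self ht) hs.1).1 hs.2, hs.1.2⟩
  have hge : volume (Icc u 1) ≤ volume {s : ℝ | s ∈ Icc (0 : ℝ) 1 ∧ q₁ t < q₂ s} :=
    measure_mono fun s hs => by
      have hs' : s ∈ Icc (0 : ℝ) 1 := ⟨hu0.le.trans hs.1, hs.2⟩
      exact ⟨hs', hu.trans_le ((hq₂.strictMonoOn.le_iff_le
        ⟨hu0.le, (hut.trans ht.2).le⟩ hs').2 hs.1)⟩
  rw [← e] at hge
  have := hge.trans hle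
  rw [Real.volume_Icc, Real.volume_Ioc, ENNReal.ofReal_le_ofReal_iff (by linarith [ht.2])] at this
  linarith

lemma eqOn_of_distribution_eq (hq₁ : Admissible q₁) (hq₂ : Admissible q₂)
    (h : distribution q₁ = distribution q₂) : EqOn q₁ q₂ (Icc 0 1) := by
  have hI : EqOn q₁ q₂ (Ioo 0 1) := fun t ht =>
    le_antisymm (le_of_distribution_eq hq₂ hq₁ h.symm ht) (le_of_distribution_eq hq₁ hq₂ h ht)
  exact hI.of_subset_closure hq₁.continuousOn hq₂.continuousOn Ioo_subset_Icc_self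
    (closure_Ioo zero_ne_one).ge

/-- Derivative of the data and the transform of `q` it yields. -/
lemma exists_hasDerivAt_data (hq : Admissible q) {α η l : ℝ} (hη : 0 < η) (hl : 0 < l)
    (hal : η ^ α < l ^ 2) :
    ∃ d, HasDerivAt (data α η q) d l ∧
      1 / l * data α η q l + d = ∫ s in (0 : ℝ)..1, 1 / Real.sqrt (l ^ 2 + η ^ α * q s) := by
  have ha : 0 < η ^ α := Real.rpow_pos_of_pos hη α
  have hG := hasDerivAt_integral_sqrt (μ := volume.restrict (Ioc (0 : ℝ) 1)) (g := q) (a := η ^ α)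
    (hq.aemeasurable.mono_measure (Measure.restrict_mono Ioc_subset_Icc_self le_rfl))
    ((ae_restrict_iff' measurableSet_Ioc).2
      (.of_forall fun t ht => hq.abs_le_one t (Ioc_subset_Icc_self ht))) ha.le hl hal
  simp only [← intervalIntegral.integral_of_le (zero_le_one (α := ℝ))] at hG
  -- With `λ` cleared from the radicand, the term `-D/λ` of the quotient rule cancels against `D/λ`.
  have hdata : ∀ m : ℝ, 0 < m →
      data α η q m = (∫ s in (0 : ℝ)..1, Real.sqrt (m ^ 2 + η ^ α * q s)) / m := by
    intro m hm
    rw [data, ← intervalIntegral.integral_div]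
    congr 1
    funext s
    rw [show 1 + η ^ α / m ^ 2 * q s = (m ^ 2 + η ^ α * q s) / m ^ 2 by field_simp,
      Real.sqrt_div' _ (by positivity), Real.sqrt_sq hm.le]
  refine ⟨_, (hG.div (hasDerivAt_id l) hl.ne').congr_of_eventuallyEq
    ((lt_mem_nhds hl).mono fun m hm => hdata m hm), ?_⟩
  have hI : ∫ s in (0 : ℝ)..1, l / Real.sqrt (l ^ 2 + η ^ α * q s)
      = l * ∫ s in (0 : ℝ)..1, 1 / Real.sqrt (l ^ 2 + η ^ α * q s) := by
    rw [← intervalIntegral.integral_const_mul]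
    simp only [mul_one_div]
  rw [hdata l hl, hI]
  simp only [id]
  field_simp
  ring

end Admissible

/-! ### The observed window, uniqueness and the transform formula -/

section Window

variable {τ α η l : ℝ}

lemma window_nontrivial (hsmall : τ * η ^ α < 1) : Real.sqrt (τ * η ^ α) < 1 := by
  rw [Real.sqrt_lt' one_pos]
  simpa using hsmall

lemma pos_of_mem_window (hτ : 1 < τ) (hη : 0 < η) (hl : l ∈ window τ α η) : 0 < l := by
  have ha : 0 < η ^ α := Real.rpow_pos_of_pos hη α
  exact (Real.sqrt_pos.2 (by positivity)).trans_le hl.1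

lemma lt_sq_of_mem_window (hτ : 1 < τ) (hη : 0 < η) (hl : l ∈ window τ α η) :
    η ^ α < l ^ 2 := by
  have ha : 0 < η ^ α := Real.rpow_pos_of_pos hη α
  have := (Real.sqrt_le_left (pos_of_mem_window hτ hη hl).le).1 hl.1
  nlinarith

end Window

namespace Admissible

variable {q q₁ q₂ : ℝ → ℝ} {τ α η l : ℝ}

lemma differentiableWithinAt_data (hq : Admissible q) (hτ : 1 < τ) (hη : 0 < η)
    (hl : l ∈ window τ α η) : DifferentiableWithinAt ℝ (data α η q) (window τ α η) l := by
  obtain ⟨d, hd, -⟩ := hq.exists_hasDerivAt_data hη (pos_of_mem_window hτ hη hl)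
    (lt_sq_of_mem_window hτ hη hl)
  exact hd.differentiableAt.differentiableWithinAt

lemma data_add_derivWithin (hq : Admissible q) (hτ : 1 < τ) (hη : 0 < η)
    (hsmall : τ * η ^ α < 1) (hl : l ∈ window τ α η) :
    1 / l * data α η q l + derivWithin (data α η q) (window τ α η) l
      = ∫ s in (0 : ℝ)..1, 1 / Real.sqrt (l ^ 2 + η ^ α * q s) := by
  obtain ⟨d, hd, h⟩ := hq.exists_hasDerivAt_data hη (pos_of_mem_window hτ hη hl)
    (lt_sq_of_mem_window hτ hη hl)
  have hu : UniqueDiffWithinAt ℝ (window τ α η) l :=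
    uniqueDiffOn_Icc (window_nontrivial hsmall) l hl
  rw [hd.hasDerivWithinAt.derivWithin hu, h]

lemma eqOn_of_data_eqOn (hq₁ : Admissible q₁) (hq₂ : Admissible q₂) (hτ : 1 < τ) (hη : 0 < η)
    (hsmall : τ * η ^ α < 1) (h : EqOn (data α η q₁) (data α η q₂) (window τ α η)) :
    EqOn q₁ q₂ (Icc 0 1) := by
  have ha : 0 < η ^ α := Real.rpow_pos_of_pos hη α
  have := isProbabilityMeasure_distribution hq₁.aemeasurable
  have := isProbabilityMeasure_distribution hq₂.aemeasurable
  refine hq₁.eqOn_of_distribution_eq hq₂ (measure_ext_of_integral_invSqrt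
    (ae_distribution_abs_le hq₁.aemeasurable hq₁.abs_le_one)
    (ae_distribution_abs_le hq₂.aemeasurable hq₂.abs_le_one)
    (u := η ^ α) (v := 1 / τ) ha.le ?_ ?_ ?_)
  · rwa [lt_div_iff₀ (by linarith), mul_comm]
  · rw [div_le_one (by linarith)]; exact hτ.le
  intro c hc
  have hc0 : 0 < c := ha.trans hc.1
  -- Solves `c = η^α / l²`; the bounds `η^α` and `1/τ` on `c` correspond to the ends `1` and `√(τ
  -- η^α)` of the window.
  set l := Real.sqrt (η ^ α / c) with hl
  have hl2 : l ^ 2 = η ^ α / c := Real.sq_sqrt (by positivity)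
  have hlw : l ∈ window τ α η := by
    refine ⟨Real.sqrt_le_sqrt ?_, ?_⟩
    · rw [le_div_iff₀ hc0]
      have : τ * c ≤ 1 := by
        have := hc.2
        rw [lt_div_iff₀ (by linarith)] at this
        linarith
      nlinarith
    · rw [hl, Real.sqrt_le_left zero_le_one, one_pow, div_le_one hc0]
      exact hc.1.le
  have hl0 := pos_of_mem_window hτ hη hlw
  have key : ∀ q : ℝ → ℝ, Admissible q →
      ∫ y, 1 / Real.sqrt (1 + c * y) ∂distribution q
        = l * (1 / l * data α η q l + derivWithin (data α η q) (window τ α η) l) := by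
    intro q hq
    rw [← integral_comp_eq_integral_distribution hq.aemeasurable (F := fun y =>
      1 / Real.sqrt (1 + c * y)) (by fun_prop), hq.data_add_derivWithin hτ hη hsmall hlw,
      ← intervalIntegral.integral_const_mul]
    congr 1
    funext s
    have hc' : l ^ 2 + η ^ α * q s = l ^ 2 * (1 + c * q s) := by
      rw [hl2]; field_simp
    rw [hc', Real.sqrt_mul (sq_nonneg l), Real.sqrt_sq hl0.le, mul_one_div,
      div_mul_cancel_left₀ hl0.ne', one_div]
  -- The derivative within the window depends only on the data there.
  rw [key q₁ hq₁, key q₂ hq₂, h hlw, derivWithin_congr h (h hlw)]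

lemma signedQ_bounded (hq : Admissible q) (σ : ℝ) : ∃ C, ∀ x, |signedQ σ q x| ≤ C := by
  obtain ⟨C, hC⟩ := hq.exists_inverseDensity_le
  exact ⟨C, fun x => hC _⟩

/-- The data in terms of the Laplace and Hankel transforms. -/
lemma data_add_derivWithin_eq_laplace (hq : Admissible q) (hτ : 1 < τ) (hη : 0 < η)
    (hsmall : τ * η ^ α < 1) (hl : l ∈ window τ α η) :
    LaplaceConverges (hankel0 (Q q)) (l / Real.sqrt (η ^ α)) ∧
    LaplaceConverges (hankelI0 (Qneg q)) (l / Real.sqrt (η ^ α)) ∧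
    1 / l * data α η q l + derivWithin (data α η q) (window τ α η) l
      = 2 / Real.sqrt (η ^ α) * (laplace (hankel0 (Q q)) (l / Real.sqrt (η ^ α))
        + laplace (hankelI0 (Qneg q)) (l / Real.sqrt (η ^ α))) := by
  have ha : 0 < η ^ α := Real.rpow_pos_of_pos hη α
  have hl0 := pos_of_mem_window hτ hη hl
  have hal := lt_sq_of_mem_window hτ hη hl
  set r := Real.sqrt (η ^ α) with hr
  have hr0 : 0 < r := Real.sqrt_pos.2 ha
  have hr2 : r ^ 2 = η ^ α := Real.sq_sqrt ha.le
  have hs : 1 < l / r := by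
    rw [lt_div_iff₀ hr0, one_mul]
    exact (Real.sqrt_lt' hl0).2 hal
  obtain ⟨C, hC⟩ := hq.signedQ_bounded 1
  obtain ⟨C', hC'⟩ := hq.signedQ_bounded (-1)
  have h1 : |(1 : ℝ)| = 1 := abs_one
  have h1' : |(-1 : ℝ)| = 1 := by simp
  have c₁ := laplaceConverges_hankel h1.le hs (measurable_signedQ 1 q) hC
    fun x hx => hq.signedQ_eq_zero h1 hx
  have c₂ := laplaceConverges_hankel h1'.le hs (measurable_signedQ (-1) q) hC'
    fun x hx => hq.signedQ_eq_zero h1' hx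
  have e₁ := laplace_hankel h1.le hs (measurable_signedQ 1 q) hC
    fun x hx => hq.signedQ_eq_zero h1 hx
  have e₂ := laplace_hankel h1'.le hs (measurable_signedQ (-1) q) hC'
    fun x hx => hq.signedQ_eq_zero h1' hx
  rw [bessel_one] at c₁ e₁
  rw [bessel_neg_one] at c₂ e₂
  have hF : IntegrableOn (fun s => 1 / Real.sqrt ((l / r) ^ 2 + q s)) (Icc 0 1) := by
    refine ContinuousOn.integrableOn_Icc (ContinuousOn.div continuousOn_const
      (continuousOn_const.add hq.continuousOn).sqrt fun t ht => ?_)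
    have := (abs_le.1 (hq.abs_le_one t ht)).1
    have : 1 < (l / r) ^ 2 := one_lt_pow₀ hs two_ne_zero
    exact (Real.sqrt_pos.2 (by linarith)).ne'
  have hsplit := hq.integral_comp_eq (F := fun y => 1 / Real.sqrt ((l / r) ^ 2 + y)) hF
  rw [← e₁, ← e₂, signedQ_one, signedQ_neg_one] at hsplit
  rw [signedQ_one] at c₁
  rw [signedQ_neg_one] at c₂
  refine ⟨c₁, c₂, ?_⟩
  rw [hq.data_add_derivWithin hτ hη hsmall hl, div_mul_eq_mul_div, eq_div_iff hr0.ne']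
  refine Eq.trans ?_ hsplit
  rw [← intervalIntegral.integral_mul_const]
  congr 1
  funext s
  -- Rescaling by `r = √(η^α)` produces the prefactor `1/r`; the factor `2` comes from the
  -- substitution.
  have : l ^ 2 + η ^ α * q s = r ^ 2 * ((l / r) ^ 2 + q s) := by
    rw [← hr2]; field_simp
  rw [this, Real.sqrt_mul (sq_nonneg r), Real.sqrt_sq hr0.le, one_div_mul_eq_div]
  rw [div_mul_cancel_left₀ hr0.ne', one_div]

lemma hankel_converges (hq : Admissible q) (r : ℝ) :
    Hankel0Converges (Q q) r ∧ HankelI0Converges (Qneg q) r := by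
  obtain ⟨C, hC⟩ := hq.signedQ_bounded 1
  obtain ⟨C', hC'⟩ := hq.signedQ_bounded (-1)
  have h1 : |(1 : ℝ)| = 1 := abs_one
  have h1' : |(-1 : ℝ)| = 1 := by simp
  have c₁ := integrableOn_hankel h1.le (measurable_signedQ 1 q) hC
    (fun x hx => hq.signedQ_eq_zero h1 hx) r
  have c₂ := integrableOn_hankel h1'.le (measurable_signedQ (-1) q) hC'
    (fun x hx => hq.signedQ_eq_zero h1' hx) r
  rw [signedQ_one, bessel_one] at c₁
  rw [signedQ_neg_one, bessel_neg_one] at c₂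
  exact ⟨c₁, c₂⟩

end Admissible

lemma Qneg_eq_zero {q : ℝ → ℝ} (h : 0 ≤ q 0) : Qneg q = 0 := by
  funext x
  exact indicator_of_notMem (fun hx => by nlinarith [hx.1, sq_nonneg x]) _

lemma laplace_hankelI0_Qneg {q : ℝ → ℝ} (h : 0 ≤ q 0) (s : ℝ) :
    laplace (hankelI0 (Qneg q)) s = 0 := by
  simp [Qneg_eq_zero h, laplace, hankelI0]

end ProblemB

end

theorem theorem1 (τ α η : ℝ) (hτ : 1 < τ) (hα : 0 < α) (hη : 0 < η) (hsmall : τ * η ^ α < 1) :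
    -- invariance under rearrangements
    (∀ q₁ q₂ : ℝ → ℝ,
      AEMeasurable q₁ (volume.restrict (Icc 0 1)) → AEMeasurable q₂ (volume.restrict (Icc 0 1)) →
      (∀ t ∈ Icc (0 : ℝ) 1, |q₁ t| ≤ 1) → (∀ t ∈ Icc (0 : ℝ) 1, |q₂ t| ≤ 1) →
      ProblemB.IsRearrangement q₁ q₂ →
      EqOn (ProblemB.data α η q₁) (ProblemB.data α η q₂) (ProblemB.window τ α η)) ∧
    -- uniqueness
    (∀ q₁ q₂ : ℝ → ℝ, ProblemB.Admissible q₁ → ProblemB.Admissible q₂ →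
      EqOn (ProblemB.data α η q₁) (ProblemB.data α η q₂) (ProblemB.window τ α η) →
      EqOn q₁ q₂ (Icc 0 1)) ∧
    -- reformulation by Laplace and Hankel transforms, nonnegative `q`
    (∀ q : ℝ → ℝ, ProblemB.Admissible q → 0 ≤ q 0 →
      (∀ r : ℝ, 0 < r → ProblemB.Hankel0Converges (ProblemB.Q q) r) ∧
      ∀ lam ∈ ProblemB.window τ α η,
        ProblemB.LaplaceConverges (ProblemB.hankel0 (ProblemB.Q q))
          (lam / Real.sqrt (η ^ α)) ∧
        DifferentiableWithinAt ℝ (ProblemB.data α η q) (ProblemB.window τ α η) lam ∧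
        1 / lam * ProblemB.data α η q lam
            + derivWithin (ProblemB.data α η q) (ProblemB.window τ α η) lam
          = 2 / Real.sqrt (η ^ α)
              * ProblemB.laplace (ProblemB.hankel0 (ProblemB.Q q)) (lam / Real.sqrt (η ^ α))) ∧
    -- the same reformulation for `q` of any sign
    (∀ q : ℝ → ℝ, ProblemB.Admissible q →
      (∀ r : ℝ, 0 < r → ProblemB.Hankel0Converges (ProblemB.Q q) r ∧
        ProblemB.HankelI0Converges (ProblemB.Qneg q) r) ∧
      ∀ lam ∈ ProblemB.window τ α η,
        ProblemB.LaplaceConverges (ProblemB.hankel0 (ProblemB.Q q))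
          (lam / Real.sqrt (η ^ α)) ∧
        ProblemB.LaplaceConverges (ProblemB.hankelI0 (ProblemB.Qneg q))
          (lam / Real.sqrt (η ^ α)) ∧
        DifferentiableWithinAt ℝ (ProblemB.data α η q) (ProblemB.window τ α η) lam ∧
        1 / lam * ProblemB.data α η q lam
            + derivWithin (ProblemB.data α η q) (ProblemB.window τ α η) lam
          = 2 / Real.sqrt (η ^ α)
              * (ProblemB.laplace (ProblemB.hankel0 (ProblemB.Q q)) (lam / Real.sqrt (η ^ α))
                + ProblemB.laplace (ProblemB.hankelI0 (ProblemB.Qneg q))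
                    (lam / Real.sqrt (η ^ α)))) := by
  refine ⟨fun q₁ q₂ hq₁ hq₂ hb₁ hb₂ h => ?_, fun q₁ q₂ hq₁ hq₂ h => ?_, fun q hq h0 => ?_,
    fun q hq => ?_⟩
  · rw [ProblemB.data_eq_of_isRearrangement hq₁ hq₂ hb₁ hb₂ h]
    exact fun _ _ => rfl
  · exact hq₁.eqOn_of_data_eqOn hq₂ hτ hη hsmall h
  · refine ⟨fun r _ => (hq.hankel_converges r).1, fun l hl => ?_⟩
    obtain ⟨h1, -, h3⟩ := hq.data_add_derivWithin_eq_laplace hτ hη hsmall hl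
    rw [ProblemB.laplace_hankelI0_Qneg h0, add_zero] at h3
    exact ⟨h1, hq.differentiableWithinAt_data hτ hη hl, h3⟩
  · refine ⟨fun r _ => hq.hankel_converges r, fun l hl => ?_⟩
    obtain ⟨h1, h2, h3⟩ := hq.data_add_derivWithin_eq_laplace hτ hη hsmall hl
    exact ⟨h1, h2, hq.differentiableWithinAt_data hτ hη hl, h3⟩
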